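/- Let $n\ge 1$, let $\Gamma$ be a discrete group, and let $\rho\colon\Gamma\to PU(n)=U(n)/Z(U(n))$ be a group homomorphism (a projective representation). Choose any set-theoretic lift $\widetilde\rho\colon\Gamma\to U(n)$ of $\rho$, let $$z(\gamma,\gamma')=\widetilde\rho(\gamma)\,\widetilde\rho(\gamma')\,\widetilde\rho(\gamma\gamma')^{-1},\qquad z\in Z^2(\Gamma,Z(U(n))),$$ be the corresponding 2-cocycle, where $\Gamma$ acts trivially on the center $Z(U(n))$, and let $\overline z\in H^2(\Gamma,Z(U(n)))$ be its cohomology class. Let $U(n)\rtimes\Gamma$ be the semidirect product for the action of $\Gamma$ on $U(n)$ in which $\gamma$ acts by $x\mapsto\widetilde\rho(\gamma)\,x\,\widetilde\rho(\gamma)^{-1}$. Automorphisms of $U(n)$ and of $U(n)\rtimes\Gamma$ are automorphisms of topological groups, and an automorphism of $U(n)$ is called outer if it is not inner. An automorphism $\alpha$ of $U(n)$ lifts to $U(n)\rtimes\Gamma$ if some automorphism of $U(n)\rtimes\Gamma$ restricts to $\alpha$ on $U(n)$. Entrywise complex conjugation is an outer automorphism of $U(n)$, and for every outer automorphism $\sigma$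 of $U(n)$ (for example complex conjugation) the following conditions are equivalent: (a) every automorphism of $U(n)$ lifts to $U(n)\rtimes\Gamma$; (b) every outer automorphism of $U(n)$ lifts to $U(n)\rtimes\Gamma$; (c) $\sigma$ lifts to $U(n)\rtimes\Gamma$; (d) $\overline z^{-1}$ lies in the orbit of $\overline z$ under the action of $\mathrm{Aut}(\Gamma)$ on $H^2(\Gamma,Z(U(n)))$. -/

import Mathlib

/-- The unitary group `U(n)`, with its usual topology as a group of complex matrices. -/
abbrev U (n : ℕ) : Type := Matrix.unitaryGroup (Fin n) ℂ

/-- The projective unitary group `PU(n) = U(n) / Z(U(n))`. -/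
abbrev PU (n : ℕ) : Type := U n ⧸ Subgroup.center (U n)

/-! ### Automorphisms of topological groups -/

/-- Inner automorphisms of a topological group. -/
def IsInnerAut {G : Type*} [Group G] [TopologicalSpace G] (α : G ≃ₜ* G) : Prop :=
  ∃ g : G, ∀ x : G, α x = g * x * g⁻¹

/-- Outer automorphisms, that is, the automorphisms which are not inner. -/
def IsOuterAut {G : Type*} [Group G] [TopologicalSpace G] (α : G ≃ₜ* G) : Prop :=
  ¬ IsInnerAut α

/-- Entrywise complex conjugation, as an automorphism of the topological group `U(n)`. -/
def complexConj (n : ℕ) : U n ≃ₜ* U n where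
  toFun := Matrix.UnitaryGroup.map_star
  invFun := Matrix.UnitaryGroup.map_star
  left_inv A := by ext i j; simp
  right_inv A := by ext i j; simp
  map_mul' A B := by
    ext i j
    simp [Matrix.mul_apply]
  continuous_toFun :=
    Continuous.subtype_mk (continuous_subtype_val.matrix_map continuous_star) _
  continuous_invFun :=
    Continuous.subtype_mk (continuous_subtype_val.matrix_map continuous_star) _

/-! ### The semidirect product attached to a projective representation -/

/-- The conjugation action of `G / Z(G)` on `G`. -/
def conjModCenter (G : Type*) [Group G] : G ⧸ Subgroup.center G →* MulAut G :=
  QuotientGroup.lift (Subgroup.center G) MulAut.conj (by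
    intro g hg
    ext x
    rw [MulAut.conj_apply, MulAut.one_apply, ← Subgroup.mem_center_iff.1 hg x, mul_assoc,
      mul_inv_cancel, mul_one])

theorem conjModCenter_mk {G : Type*} [Group G] (g x : G) :
    conjModCenter G (g : G ⧸ Subgroup.center G) x = g * x * g⁻¹ := rfl

/-- The action of `Γ` on `G` by conjugation induced by a projective representation
`ρ : Γ → G / Z(G)`: for any `g : G` lifting `ρ γ`, the element `γ` acts as `x ↦ g x g⁻¹`. -/
def projAction {G Γ : Type*} [Group G] [Group Γ] (ρ : Γ →* G ⧸ Subgroup.center G) :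
    Γ →* MulAut G :=
  (conjModCenter G).comp ρ

/-- The semidirect product `G ⋊ Γ` attached to a projective representation of `Γ` in `G`. -/
abbrev ProjSemidirect {G Γ : Type*} [Group G] [Group Γ]
    (ρ : Γ →* G ⧸ Subgroup.center G) : Type _ :=
  G ⋊[projAction ρ] Γ

/-- The underlying space of a semidirect product is the product space. -/
instance semidirectTopology {N H : Type*} [Group N] [Group H] [TopologicalSpace N]
    [TopologicalSpace H] (φ : H →* MulAut N) : TopologicalSpace (N ⋊[φ] H) :=
  TopologicalSpace.induced (fun x => (x.left, x.right)) inferInstance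

/-- The automorphism `α` of `G` lifts to an automorphism of `G ⋊ Γ`: some automorphism of the
topological group `G ⋊ Γ` restricts to `α` along the canonical embedding of `G`. -/
def LiftsToSemidirect {G Γ : Type*} [Group G] [TopologicalSpace G] [Group Γ] [TopologicalSpace Γ]
    (ρ : Γ →* G ⧸ Subgroup.center G) (α : G ≃ₜ* G) : Prop :=
  ∃ Φ : ProjSemidirect ρ ≃ₜ* ProjSemidirect ρ,
    ∀ x : G, Φ (SemidirectProduct.inl x) = SemidirectProduct.inl (α x)

/-! ### Second cohomology with trivial coefficients -/

universe u

section Cohomology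

open groupCohomology CategoryTheory
open scoped IsMulCommutative

/-- The abelian group `M`, written additively, with the trivial action of `Γ`. The lifts to the
universe of `Γ` are there only because group cohomology is set up within one universe. -/
noncomputable abbrev trivialCoeff (Γ : Type u) [Group Γ] (M : Type) [CommGroup M] :
    Rep.{u} (ULift.{u} ℤ) Γ :=
  Rep.trivial (ULift.{u} ℤ) Γ (ULift.{u} (Additive M))

/-- The cohomology group `H²(Γ, M)` for the trivial action of `Γ` on `M`, written additively. -/
noncomputable abbrev TrivH2 (Γ : Type u) [Group Γ] (M : Type) [CommGroup M] : Type u :=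
  groupCohomology.H2 (trivialCoeff Γ M)

/-- The map on `H²(Γ, M)` induced by an endomorphism `f` of `Γ`: on cocycles it is
`z ↦ ((γ, γ') ↦ z (f γ, f γ'))`. -/
noncomputable def pullbackH2 {Γ : Type u} [Group Γ] (M : Type) [CommGroup M] (f : Γ →* Γ) :
    groupCohomology.H2 (trivialCoeff Γ M) ⟶ groupCohomology.H2 (trivialCoeff Γ M) :=
  groupCohomology.map f
    (Rep.ofHom ⟨LinearMap.id, fun _ => rfl⟩ : Rep.res f (trivialCoeff Γ M) ⟶ trivialCoeff Γ M) 2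

theorem pullbackH2_id {Γ : Type u} [Group Γ] (M : Type) [CommGroup M] :
    pullbackH2 M (MonoidHom.id Γ) = 𝟙 _ :=
  groupCohomology.map_id 2

theorem pullbackH2_comp {Γ : Type u} [Group Γ] (M : Type) [CommGroup M] (f g : Γ →* Γ) :
    pullbackH2 M (f.comp g) = pullbackH2 M f ≫ pullbackH2 M g := by
  unfold pullbackH2
  rw [← groupCohomology.map_comp]
  exact groupCohomology.map_congr rfl rfl 2

/-- The action of `Aut(Γ)` on `H²(Γ, M)`: an automorphism `θ` takes the class of `z` to the class
of `(γ, γ') ↦ z (θ⁻¹ γ, θ⁻¹ γ')`. -/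
noncomputable instance autActionH2 (Γ : Type u) [Group Γ] (M : Type) [CommGroup M] :
    MulAction (MulAut Γ) (TrivH2 Γ M) where
  smul θ c := (pullbackH2 M (θ⁻¹ : MulAut Γ).toMonoidHom).hom c
  one_smul c := by
    change (pullbackH2 M (MonoidHom.id Γ)).hom c = c
    rw [pullbackH2_id]
    rfl
  mul_smul θ η c := by
    change (pullbackH2 M ((η⁻¹ : MulAut Γ).toMonoidHom.comp (θ⁻¹ : MulAut Γ).toMonoidHom)).hom c = _
    rw [pullbackH2_comp]
    rfl

/-! ### The cocycle of a projective representation -/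

/-- For a set-theoretic lift `r : Γ → G` of `ρ`, the central element
`r(γ) r(γ') r(γγ')⁻¹`. -/
def projCocycle {G : Type} {Γ : Type u} [Group G] [Group Γ] (ρ : Γ →* G ⧸ Subgroup.center G)
    (r : Γ → G) (hr : ∀ γ, (r γ : G ⧸ Subgroup.center G) = ρ γ) (p : Γ × Γ) :
    Subgroup.center G :=
  ⟨r p.1 * r p.2 * (r (p.1 * p.2))⁻¹, by
    rw [← QuotientGroup.eq_one_iff]
    simp [hr]⟩

/-- The 2-cocycle `z(γ, γ') = r(γ) r(γ') r(γγ')⁻¹` in `Z²(Γ, Z(G))`. -/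
def projCocycle₂ {G : Type} {Γ : Type u} [Group G] [Group Γ] (ρ : Γ →* G ⧸ Subgroup.center G)
    (r : Γ → G) (hr : ∀ γ, (r γ : G ⧸ Subgroup.center G) = ρ γ) :
    cocycles₂ (trivialCoeff Γ (Subgroup.center G)) :=
  ⟨fun p => ULift.up (Additive.ofMul (projCocycle ρ r hr p)), by
    rw [mem_cocycles₂_iff]
    intro g h j
    have key : projCocycle ρ r hr (g * h, j) * projCocycle ρ r hr (g, h) =
        projCocycle ρ r hr (h, j) * projCocycle ρ r hr (g, h * j) := by
      have hc := Subgroup.mem_center_iff.1 (projCocycle ρ r hr (g, h)).2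
      have hd := Subgroup.mem_center_iff.1 (projCocycle ρ r hr (h, j)).2
      apply Subtype.ext
      rw [mul_comm]
      simp only [Subgroup.coe_mul]
      have hd' := hd (r g)
      simp only [projCocycle] at hd' ⊢
      calc _ = r g * (r h * r j * (r (h * j))⁻¹) * r (h * j) * (r (g * (h * j)))⁻¹ := by
            rw [mul_assoc g h j]; group
        _ = _ := by rw [hd']; group
    exact congrArg (fun x => ULift.up (Additive.ofMul x)) key⟩

/-- The cohomology class `z̄` in `H²(Γ, Z(G))` of the 2-cocycle of a projective representation. -/
noncomputable def projClass {G : Type} {Γ : Type u} [Group G] [Group Γ]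
    (ρ : Γ →* G ⧸ Subgroup.center G)
    (r : Γ → G) (hr : ∀ γ, (r γ : G ⧸ Subgroup.center G) = ρ γ) :
    TrivH2 Γ (Subgroup.center G) :=
  (H2π (trivialCoeff Γ (Subgroup.center G))).hom (projCocycle₂ ρ r hr)

end Cohomology

/-! An automorphism of `U n` preserves the centre, a circle, and acts on it by identity or
inversion. The crux is that acting trivially there forces it to be inner
(`isInnerAut_of_fixes_scalars`), so every outer automorphism inverts the centre. For the crux, the
restriction to the diagonal torus is, up to conjugation, given by an integer matrix `M`. Fixed
scalars, Weyl symmetry and injectivity on `p`-torsion force `M` to be a permutation matrix, so the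
trace is preserved. Nondegeneracy of the trace form then gives an extension to an algebra
automorphism of the matrix algebra, which is conjugation by an invertible matrix, and that matrix
rescales to a unitary one. A lift `Φ` of `α` induces `θ` on `Γ`, and `Φ γ = a(γ) θ(γ)`. Then `c(γ) =
a(γ) r(θγ) α(rγ)⁻¹` is central, and multiplicativity of `Φ` says that `θ*z · α(z)⁻¹` is the
coboundary of `c`. For outer `α` this is `θ*z · z = dc`, which no longer mentions `α`; the
computation reverses. Inner automorphisms always lift. -/

/-! ### Characters of the circle. -/

open MeasureTheory in
/-- The continuous characters of the circle group are the power maps. -/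
theorem Circle.exists_eq_zpow_of_continuous (χ : Circle →* Circle) (hχ : Continuous χ) :
    ∃ k : ℤ, ∀ z, χ z = z ^ k := by
  have : Fact ((0 : ℝ) < 2 * Real.pi) := ⟨Real.two_pi_pos⟩
  let f : C(AddCircle (2 * Real.pi), ℂ) :=
    ⟨fun x => χ (AddCircle.toCircle x), by
      have := AddCircle.continuous_toCircle (T := 2 * Real.pi)
      fun_prop⟩
  -- If all coefficients vanished, the Fourier series would give `f 0 = 0`, but `f 0 = 1`.
  obtain ⟨k, hk⟩ : ∃ k, fourierCoeff f k ≠ 0 := by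
    by_contra! h
    have hs := has_pointwise_sum_fourier_series_of_summable (f := f)
      (by rw [show fourierCoeff f = 0 from funext h]; exact summable_zero) 0
    simp only [h, zero_smul] at hs
    have h0 := hs.unique hasSum_zero
    simp [f] at h0
  refine ⟨k, fun z => ?_⟩
  obtain ⟨a, rfl⟩ : ∃ a : AddCircle (2 * Real.pi), a.toCircle = z :=
    (AddCircle.homeomorphCircle Real.two_pi_pos.ne').surjective z |>.imp fun a ha => by
      rw [← AddCircle.homeomorphCircle_apply Real.two_pi_pos.ne', ha]
  -- Translating the integral by `a` multiplies the integrand by the constant `fourier (-k) a * f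
  -- a`, which must therefore be `1`.
  have key : fourierCoeff f k =
      (fourier (-k) a * f a) * fourierCoeff f k := by
    simp only [fourierCoeff]
    rw [← integral_const_mul, ← integral_add_left_eq_self _ a]
    congr 1 with x
    have h1 : f (a + x) = f a * f x := by simp [f, AddCircle.toCircle_add]
    have h2 : (fourier (-k) (a + x) : ℂ) = fourier (-k) a * fourier (-k) x := by
      simp only [fourier_apply, smul_add, AddCircle.toCircle_add, Circle.coe_mul]
    rw [h1, h2, smul_eq_mul, smul_eq_mul]
    ring
  have h1 : fourier (-k) a * f a = 1 := by
    have := mul_right_cancel₀ hk ((one_mul _).trans key)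
    exact this.symm
  rw [fourier_apply, neg_smul, AddCircle.toCircle_neg, AddCircle.toCircle_zsmul] at h1
  have h2 : (a.toCircle ^ k)⁻¹ * χ a.toCircle = 1 := Circle.ext (by simpa [f] using h1)
  exact (inv_mul_eq_one.mp h2).symm

/-! ### Scalars, diagonal torus and permutation matrices in `U n`. -/

open scoped Matrix.Norms.L2Operator in
theorem span_unitaryGroup (n : ℕ) :
    Submodule.span ℂ (Matrix.unitaryGroup (Fin n) ℂ : Set (Matrix (Fin n) (Fin n) ℂ)) = ⊤ :=
  CStarAlgebra.span_unitary _

/-- A matrix commuting with all unitary matrices is scalar. -/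
theorem exists_eq_scalar_of_commute_unitary {n : ℕ} (A : Matrix (Fin n) (Fin n) ℂ)
    (hA : ∀ u : U n, (u : Matrix (Fin n) (Fin n) ℂ) * A = A * u) :
    ∃ c : ℂ, A = Matrix.scalar (Fin n) c := by
  have h : ∀ B : Matrix (Fin n) (Fin n) ℂ, B * A = A * B := by
    intro B
    have hB : B ∈ Submodule.span ℂ
        (Matrix.unitaryGroup (Fin n) ℂ : Set (Matrix (Fin n) (Fin n) ℂ)) := by
      rw [span_unitaryGroup]; trivial
    induction hB using Submodule.span_induction with
    | mem x hx => exact hA ⟨x, hx⟩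
    | zero => simp
    | add x y _ _ hx hy => rw [add_mul, mul_add, hx, hy]
    | smul c x _ hx => rw [smul_mul_assoc, mul_smul_comm, hx]
  have := Matrix.mem_range_scalar_of_commute_single (M := A) fun i j _ => h _
  obtain ⟨c, hc⟩ := this
  exact ⟨c, hc.symm⟩

/-- The diagonal torus of `U(n)`. -/
def diagTorus (n : ℕ) : (Fin n → Circle) →* U n where
  toFun t := ⟨Matrix.diagonal fun i => (t i : ℂ), by
    rw [Matrix.mem_unitaryGroup_iff, Matrix.star_eq_conjTranspose, Matrix.diagonal_conjTranspose,
      Matrix.diagonal_mul_diagonal, ← Matrix.diagonal_one]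
    congr 1 with i
    simp [Complex.mul_conj]⟩
  map_one' := Subtype.ext (by simp)
  map_mul' s t := Subtype.ext (by simp [Matrix.diagonal_mul_diagonal])

theorem coe_diagTorus {n : ℕ} (t : Fin n → Circle) :
    (diagTorus n t : Matrix (Fin n) (Fin n) ℂ) = Matrix.diagonal fun i => (t i : ℂ) := rfl

theorem continuous_diagTorus (n : ℕ) : Continuous (diagTorus n) :=
  Continuous.subtype_mk (Continuous.matrix_diagonal (by fun_prop)) _

theorem diagTorus_injective (n : ℕ) : Function.Injective (diagTorus n) := by
  intro s t h
  have h' := Matrix.diagonal_injective (congrArg Subtype.val h)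
  funext i
  exact Circle.ext (congrFun h' i)

/-- The scalar matrices in `U(n)`. -/
noncomputable def scalarU (n : ℕ) : Circle →* U n :=
  (diagTorus n).comp (Pi.constMonoidHom (Fin n) Circle)

theorem scalarU_apply {n : ℕ} (z : Circle) : scalarU n z = diagTorus n fun _ => z := rfl

theorem coe_scalarU {n : ℕ} (z : Circle) :
    (scalarU n z : Matrix (Fin n) (Fin n) ℂ) = Matrix.scalar (Fin n) (z : ℂ) := rfl

theorem scalarU_injective {n : ℕ} (hn : 1 ≤ n) : Function.Injective (scalarU n) := by
  intro z w h
  exact congrFun (diagTorus_injective n h) ⟨0, hn⟩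

theorem mem_center_iff_scalarU {n : ℕ} (hn : 1 ≤ n) (u : U n) :
    u ∈ Subgroup.center (U n) ↔ ∃ z, scalarU n z = u := by
  rw [Subgroup.mem_center_iff]
  constructor
  · intro h
    obtain ⟨c, hc⟩ := exists_eq_scalar_of_commute_unitary (u : Matrix (Fin n) (Fin n) ℂ)
      fun g => congrArg Subtype.val (h g)
    have h1 := Matrix.UnitaryGroup.star_mul_self u
    rw [hc, Matrix.scalar_apply, Matrix.star_eq_conjTranspose, Matrix.diagonal_conjTranspose,
      Matrix.diagonal_mul_diagonal] at h1
    have h2 := congrFun (congrFun h1 ⟨0, hn⟩) ⟨0, hn⟩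
    simp only [Matrix.diagonal_apply_eq, Matrix.one_apply_eq, Pi.star_apply] at h2
    have h3 : ‖c‖ = 1 := by
      have := congrArg norm h2
      simp only [RCLike.star_def, norm_mul, RCLike.norm_conj, norm_one] at this
      nlinarith [norm_nonneg c]
    exact ⟨⟨c, by simpa [Submonoid.unitSphere] using h3⟩, Subtype.ext hc.symm⟩
  · rintro ⟨z, rfl⟩ g
    apply Subtype.ext
    simp only [Submonoid.coe_mul, coe_scalarU]
    exact (Matrix.scalar_commute (z : ℂ) (fun r => mul_comm _ _) _).symm.eq

/-- The unitary matrix of a permutation. -/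
def permU {n : ℕ} (w : Equiv.Perm (Fin n)) : U n :=
  ⟨w.permMatrix ℂ, by
    rw [Matrix.mem_unitaryGroup_iff, Matrix.star_eq_conjTranspose,
      Matrix.conjTranspose_permMatrix, ← Matrix.permMatrix_mul, inv_mul_cancel,
      Matrix.permMatrix_one]⟩

/-- The Weyl group action on the torus, later the source of the symmetry of the weights. -/
theorem permU_mul_diagTorus {n : ℕ} (w : Equiv.Perm (Fin n)) (t : Fin n → Circle) :
    permU w * diagTorus n t = diagTorus n (t ∘ w) * permU w := by
  apply Subtype.ext
  ext i j
  simp only [Submonoid.coe_mul, coe_diagTorus, Matrix.mul_diagonal, Matrix.diagonal_mul, permU,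
    Equiv.Perm.permMatrix, PEquiv.toMatrix_apply, Equiv.toPEquiv_apply, Function.comp_apply]
  by_cases h : j ∈ some (w i)
  · simp only [Option.mem_def, Option.some.injEq] at h
    simp [h]
  · simp [h]

theorem exists_diagTorus_eq_of_eq_diagonal {n : ℕ} (u : U n) (c : Fin n → ℂ)
    (h : (u : Matrix (Fin n) (Fin n) ℂ) = Matrix.diagonal c) : ∃ t, u = diagTorus n t := by
  have h1 := Matrix.UnitaryGroup.star_mul_self u
  rw [h, Matrix.star_eq_conjTranspose, Matrix.diagonal_conjTranspose,
    Matrix.diagonal_mul_diagonal] at h1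
  have h3 : ∀ i, ‖c i‖ = 1 := by
    intro i
    have h2 := congrFun (congrFun h1 i) i
    simp only [Matrix.diagonal_apply_eq, Matrix.one_apply_eq, Pi.star_apply] at h2
    have := congrArg norm h2
    simp only [RCLike.star_def, norm_mul, RCLike.norm_conj, norm_one] at this
    nlinarith [norm_nonneg (c i)]
  exact ⟨fun i => ⟨c i, by simpa [Submonoid.unitSphere] using h3 i⟩, Subtype.ext h⟩

/-! ### Simultaneous diagonalization. -/

/-- A commuting family of Hermitian matrices has an orthonormal basis of joint eigenvectors. -/
theorem exists_orthonormalBasis_joint_eigenvectors {n : ℕ} {κ : Type*}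
    (T : κ → Module.End ℂ (EuclideanSpace ℂ (Fin n))) (hT : ∀ k, (T k).IsSymmetric)
    (hc : ∀ k l, Commute (T k) (T l)) :
    ∃ b : OrthonormalBasis (Fin n) ℂ (EuclideanSpace ℂ (Fin n)),
      ∀ j k, ∃ c : ℂ, T k (b j) = c • b j := by
  classical
  have hint := LinearMap.IsSymmetric.directSum_isInternal_of_pairwise_commute hT
    (fun k l _ => hc k l)
  have hof := LinearMap.IsSymmetric.orthogonalFamily_iInf_eigenspaces hT
  -- All families `γ` of candidate eigenvalues are allowed; zero spaces contribute empty bases.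
  let v := fun γ : κ → ℂ => stdOrthonormalBasis ℂ
    (⨅ j, Module.End.eigenspace (T j) (γ j) : Submodule ℂ (EuclideanSpace ℂ (Fin n)))
  let B := hint.collectedBasis fun γ => (v γ).toBasis
  have hB : Orthonormal ℂ B := by
    have := hof.orthonormal_sigma_orthonormal (v_family := fun γ => v γ) fun γ => (v γ).orthonormal
    simpa [B] using this
  have : Fintype (Σ γ : κ → ℂ, Fin (Module.finrank ℂ
    (⨅ j, Module.End.eigenspace (T j) (γ j) : Submodule ℂ (EuclideanSpace ℂ (Fin n))))) :=
    FiniteDimensional.fintypeBasisIndex B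
  have hcard : Fintype.card (Σ γ : κ → ℂ, Fin (Module.finrank ℂ
    (⨅ j, Module.End.eigenspace (T j) (γ j) : Submodule ℂ (EuclideanSpace ℂ (Fin n))))) =
      Fintype.card (Fin n) := by
    rw [← Module.finrank_eq_card_basis B, finrank_euclideanSpace]
  let e := Fintype.equivOfCardEq hcard
  refine ⟨(B.toOrthonormalBasis hB).reindex e, fun j k => ?_⟩
  obtain ⟨⟨γ, m⟩, rfl⟩ := e.surjective j
  refine ⟨γ k, ?_⟩
  have hm := hint.collectedBasis_mem (fun γ => (v γ).toBasis) ⟨γ, m⟩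
  rw [Submodule.mem_iInf] at hm
  rw [OrthonormalBasis.reindex_apply, e.symm_apply_apply]
  simpa [B] using Module.End.mem_eigenspace_iff.mp (hm k)

/-- Commuting unitary matrices can be diagonalized simultaneously by a unitary matrix. -/
theorem exists_diagonalize_commuting {n : ℕ} {ι : Type*} (u : ι → U n)
    (hu : ∀ i j, Commute (u i) (u j)) :
    ∃ g : U n, ∀ i, ∃ t : Fin n → Circle, u i = g * diagTorus n t * g⁻¹ := by
  -- The Hermitian matrices `u + u*` and `i(u - u*)` determine `u` as `(A_true - i A_false) / 2`.
  let A : ι × Bool → Matrix (Fin n) (Fin n) ℂ := fun p =>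
    if p.2 then (u p.1 : Matrix (Fin n) (Fin n) ℂ) + star (u p.1 : Matrix (Fin n) (Fin n) ℂ)
    else Complex.I •
      ((u p.1 : Matrix (Fin n) (Fin n) ℂ) - star (u p.1 : Matrix (Fin n) (Fin n) ℂ))
  have hA : ∀ p, (A p).IsHermitian := by
    rintro ⟨i, _ | _⟩
    · simp [A, Matrix.IsHermitian, Matrix.star_eq_conjTranspose, ← smul_neg]
    · simp [A, Matrix.IsHermitian, Matrix.star_eq_conjTranspose, add_comm]
  have h1 : ∀ i j, Commute (u i : Matrix (Fin n) (Fin n) ℂ) (u j) := fun i j =>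
    congrArg Subtype.val (hu i j).eq
  have h2 : ∀ i j, Commute (u i : Matrix (Fin n) (Fin n) ℂ)
      (star (u j : Matrix (Fin n) (Fin n) ℂ)) := fun i j =>
    congrArg Subtype.val ((hu i j).inv_right).eq
  have h3 : ∀ i j, Commute (star (u i : Matrix (Fin n) (Fin n) ℂ))
      (star (u j : Matrix (Fin n) (Fin n) ℂ)) := fun i j =>
    congrArg Subtype.val ((hu i j).inv_inv).eq
  have hAc : ∀ p q, Commute (A p) (A q) := by
    rintro ⟨i, b⟩ ⟨j, b'⟩
    have hp : Commute ((u i : Matrix (Fin n) (Fin n) ℂ) + star (u i : Matrix (Fin n) (Fin n) ℂ))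
        ((u j : Matrix (Fin n) (Fin n) ℂ) + star (u j : Matrix (Fin n) (Fin n) ℂ)) :=
      ((h1 i j).add_left (h2 j i).symm).add_right ((h2 i j).add_left (h3 i j))
    have hq : ∀ i j, Commute
        ((u i : Matrix (Fin n) (Fin n) ℂ) + star (u i : Matrix (Fin n) (Fin n) ℂ))
        ((u j : Matrix (Fin n) (Fin n) ℂ) - star (u j : Matrix (Fin n) (Fin n) ℂ)) := fun i j =>
      ((h1 i j).add_left (h2 j i).symm).sub_right ((h2 i j).add_left (h3 i j))
    have hr : Commute ((u i : Matrix (Fin n) (Fin n) ℂ) - star (u i : Matrix (Fin n) (Fin n) ℂ))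
        ((u j : Matrix (Fin n) (Fin n) ℂ) - star (u j : Matrix (Fin n) (Fin n) ℂ)) :=
      ((h1 i j).sub_left (h2 j i).symm).sub_right ((h2 i j).sub_left (h3 i j))
    cases b <;> cases b' <;> simp only [A, if_true, Bool.false_eq_true, if_false]
    · exact (hr.smul_left _).smul_right _
    · exact (hq j i).symm.smul_left _
    · exact (hq i j).smul_right _
    · exact hp
  obtain ⟨b, hb⟩ := exists_orthonormalBasis_joint_eigenvectors
    (fun p => Matrix.toEuclideanLin (A p))
    (fun p => Matrix.isSymmetric_toEuclideanLin_iff.mpr (hA p)) (fun p q => by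
      have := (hAc p q).eq
      change Matrix.toEuclideanLin (A p) ∘ₗ Matrix.toEuclideanLin (A q) =
        Matrix.toEuclideanLin (A q) ∘ₗ Matrix.toEuclideanLin (A p)
      rw [← Matrix.toLpLin_mul_same, ← Matrix.toLpLin_mul_same, this])
  let g : U n := ⟨(EuclideanSpace.basisFun (Fin n) ℂ).toBasis.toMatrix b,
    OrthonormalBasis.toMatrix_orthonormalBasis_mem_unitary _ _⟩
  have hg : ∀ i j, (g : Matrix (Fin n) (Fin n) ℂ) i j = b j i := fun i j => by
    simp [g, Module.Basis.toMatrix_apply]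
  refine ⟨g, fun i => ?_⟩
  choose c hc using fun j => hb j (i, true)
  choose d hd using fun j => hb j (i, false)
  have hug : (u i : Matrix (Fin n) (Fin n) ℂ) * g =
      g * Matrix.diagonal fun j => (c j - Complex.I * d j) / 2 := by
    have hAc' : A (i, true) * g = g * Matrix.diagonal c := by
      ext k j
      have := congrArg (fun v : EuclideanSpace ℂ (Fin n) => v k) (hc j)
      simp only [Matrix.mul_diagonal, hg]
      simp only [Matrix.toLpLin_apply, PiLp.smul_apply, smul_eq_mul] at this
      rw [mul_comm, ← this, Matrix.mul_apply]
      simp [Matrix.mulVec, dotProduct, hg]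
    have hAd' : A (i, false) * g = g * Matrix.diagonal d := by
      ext k j
      have := congrArg (fun v : EuclideanSpace ℂ (Fin n) => v k) (hd j)
      simp only [Matrix.mul_diagonal, hg]
      simp only [Matrix.toLpLin_apply, PiLp.smul_apply, smul_eq_mul] at this
      rw [mul_comm, ← this, Matrix.mul_apply]
      simp [Matrix.mulVec, dotProduct, hg]
    have hu2 : (u i : Matrix (Fin n) (Fin n) ℂ) =
        (1 / 2 : ℂ) • (A (i, true) - Complex.I • A (i, false)) := by
      simp only [A, if_true, Bool.false_eq_true, if_false, smul_smul, Complex.I_mul_I]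
      module
    rw [hu2, smul_mul_assoc, sub_mul, smul_mul_assoc, hAc', hAd']
    ext k j
    simp only [Matrix.smul_apply, Matrix.sub_apply, Matrix.mul_diagonal, smul_eq_mul]
    ring
  have hdiag : ((g⁻¹ * u i * g : U n) : Matrix (Fin n) (Fin n) ℂ) =
      Matrix.diagonal fun j => (c j - Complex.I * d j) / 2 := by
    rw [mul_assoc, Submonoid.coe_mul, Submonoid.coe_mul, hug, ← mul_assoc, ← Submonoid.coe_mul,
      inv_mul_cancel, Submonoid.coe_one, one_mul]
  obtain ⟨t, ht⟩ := exists_diagTorus_eq_of_eq_diagonal _ _ hdiag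
  exact ⟨t, by rw [← ht]; group⟩

/-! ### Integer matrices with symmetric Gram matrix. -/

open Matrix in
/-- An integer matrix with row sums `1`, with permutation invariant Gram matrix and with nonzero
determinant modulo every prime has orthonormal columns. -/
theorem transpose_mul_self_eq_one_of_invariant {n : ℕ} (M : Matrix (Fin n) (Fin n) ℤ)
    (hrow : ∀ j, ∑ i, M j i = 1)
    (hinv : ∀ (w : Equiv.Perm (Fin n)) a b, (Mᵀ * M) (w a) (w b) = (Mᵀ * M) a b)
    (hdet : ∀ p : ℕ, p.Prime → ¬ (p : ℤ) ∣ M.det) : Mᵀ * M = 1 := by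
  set S := Mᵀ * M with hS
  -- This is the squared length of `M` applied to the all-ones vector, which `M` fixes.
  have hsum : ∑ a, ∑ b, S a b = n := by
    have h1 : ∀ a, ∑ b, S a b = ∑ j, M j a := fun a => by
      simp only [hS, Matrix.mul_apply, Matrix.transpose_apply]
      rw [Finset.sum_comm]
      simp only [← Finset.mul_sum, hrow, mul_one]
    simp only [h1]
    rw [Finset.sum_comm]
    simp [hrow]
  rcases Nat.lt_or_ge n 2 with hn | hn
  · interval_cases n
    · exact Subsingleton.elim _ _
    · ext a b
      simp only [Fin.sum_univ_one, Nat.cast_one] at hsum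
      rw [Subsingleton.elim a 0, Subsingleton.elim b 0, Matrix.one_apply_eq]
      exact hsum
  let i0 : Fin n := ⟨0, by omega⟩
  let i1 : Fin n := ⟨1, by omega⟩
  have h01 : i0 ≠ i1 := by simp [i0, i1]
  obtain ⟨y, hy⟩ : ∃ y, S i0 i1 = y := ⟨_, rfl⟩
  obtain ⟨x, hx⟩ : ∃ x, S i0 i0 = x + y := ⟨S i0 i0 - y, by ring⟩
  -- Permutations act transitively on ordered pairs of distinct indices, so `S` is `x` times the
  -- identity plus `y` times the all-ones matrix.
  have hoff : ∀ a b, a ≠ b → S a b = y := by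
    intro a b hab
    obtain ⟨w, hw0, hw1⟩ : ∃ w : Equiv.Perm (Fin n), w i0 = a ∧ w i1 = b := by
      let w₁ := Equiv.swap i0 a
      have hne : w₁ i1 ≠ a := fun h => h01 (w₁.injective (by
        rw [h]; exact Equiv.swap_apply_left _ _))
      refine ⟨Equiv.swap (w₁ i1) b * w₁, ?_, ?_⟩
      · rw [Equiv.Perm.mul_apply, show w₁ i0 = a from Equiv.swap_apply_left _ _]
        exact Equiv.swap_apply_of_ne_of_ne hne.symm hab
      · rw [Equiv.Perm.mul_apply, Equiv.swap_apply_left]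
    rw [← hw0, ← hw1, hinv, hy]
  have hdiag : ∀ a, S a a = x + y := by
    intro a
    have := hinv (Equiv.swap i0 a) i0 i0
    rw [Equiv.swap_apply_left] at this
    rw [this, hx]
  have hSab : ∀ a b, S a b = (if a = b then x else 0) + y := by
    intro a b
    split_ifs with h
    · rw [h, hdiag]
    · rw [hoff a b h, zero_add]
  have hxy : x + n * y = 1 := by
    simp only [hSab, Finset.sum_add_distrib, Finset.sum_ite_eq, Finset.mem_univ, if_true,
      Finset.sum_const, Finset.card_univ, Fintype.card_fin, nsmul_eq_mul] at hsum
    have hn0 : (n : ℤ) ≠ 0 := by omega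
    apply mul_left_cancel₀ hn0
    linarith
  -- `2 * x` is the squared distance between two columns of `M`.
  have hx0 : 0 ≤ x := by
    have h1 : ∑ j, (M j i0 - M j i1) ^ 2 = 2 * x := by
      have e : ∀ a b, ∑ j, M j a * M j b = S a b := fun a b => by
        simp [hS, Matrix.mul_apply]
      have : ∀ j, (M j i0 - M j i1) ^ 2 =
          M j i0 * M j i0 - 2 * (M j i0 * M j i1) + M j i1 * M j i1 := fun j => by ring
      simp only [this, Finset.sum_add_distrib, Finset.sum_sub_distrib, ← Finset.mul_sum, e,
        hdiag, hy]
      ring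
    have := Finset.sum_nonneg fun j (_ : j ∈ Finset.univ) => sq_nonneg (M j i0 - M j i1)
    omega
  -- Modulo a prime dividing `x`, every row of `S` is constant, so `S` kills `e₀ - e₁` and `det S =
  -- (det M)²` vanishes. This also excludes `x = 0`.
  have hx1 : x.natAbs = 1 := by
    by_contra hne
    obtain ⟨p, hp, hpx⟩ := Nat.exists_prime_and_dvd hne
    refine hdet p hp ?_
    have : Fact p.Prime := ⟨hp⟩
    have hpx' : ((x : ℤ) : ZMod p) = 0 :=
      (ZMod.intCast_zmod_eq_zero_iff_dvd _ _).mpr (Int.natCast_dvd.mpr hpx)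
    have hker : (S.map (Int.castRingHom (ZMod p))) *ᵥ (Pi.single i0 1 - Pi.single i1 1) = 0 := by
      ext a
      simp only [Matrix.mulVec_sub, Matrix.mulVec_single_one, Pi.sub_apply, Matrix.col_apply,
        Matrix.map_apply, hSab, Pi.zero_apply]
      split_ifs <;> simp [hpx']
    have hne' : (Pi.single i0 1 - Pi.single i1 1 : Fin n → ZMod p) ≠ 0 := by
      intro h
      have := congrFun h i0
      simp [h01] at this
    have hd := (Matrix.exists_mulVec_eq_zero_iff (M := S.map (Int.castRingHom (ZMod p)))).mp
      ⟨_, hne', hker⟩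
    rw [hS, Matrix.map_mul, Matrix.det_mul, Matrix.transpose_map, Matrix.det_transpose,
      mul_self_eq_zero] at hd
    have hd' := (RingHom.map_det (Int.castRingHom (ZMod p)) M).trans hd
    exact (ZMod.intCast_zmod_eq_zero_iff_dvd _ _).mp hd'
  -- With `x = 1`, the relation `x + n * y = 1` leaves `y = 0`.
  have hx1' : x = 1 := by omega
  have hy0 : y = 0 := by
    have : (n : ℤ) * y = 0 := by omega
    rcases mul_eq_zero.mp this with h | h
    · omega
    · exact h
  ext a b
  rw [hSab, hx1', hy0, add_zero, Matrix.one_apply]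

open Matrix in
/-- An integer matrix with row sums `1` and orthonormal columns is a permutation matrix. -/
theorem exists_perm_of_transpose_mul_self_eq_one {n : ℕ} (M : Matrix (Fin n) (Fin n) ℤ)
    (hrow : ∀ j, ∑ i, M j i = 1) (hM : Mᵀ * M = 1) :
    ∃ w : Equiv.Perm (Fin n), ∀ j, M j = Pi.single (w j) 1 := by
  have hM' : M * Mᵀ = 1 := mul_eq_one_comm.mp hM
  have hsq : ∀ j, ∑ i, M j i * M j i = 1 := fun j => by
    have := congrFun (congrFun hM' j) j
    simpa [Matrix.mul_apply] using this
  -- For integers `m² - m ≥ 0`, while each row of `M` has both sum and sum of squares equal to `1`.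
  have h01 : ∀ j i, M j i * M j i - M j i = 0 := by
    intro j i
    have hnn : ∀ i ∈ Finset.univ, 0 ≤ M j i * M j i - M j i := fun i _ => by
      rcases le_or_gt (M j i) 0 with h | h <;> nlinarith
    refine (Finset.sum_eq_zero_iff_of_nonneg hnn).mp ?_ i (Finset.mem_univ i)
    rw [Finset.sum_sub_distrib, hsq, hrow, sub_self]
  have hval : ∀ j i, M j i = 0 ∨ M j i = 1 := fun j i => by
    have : M j i * (M j i - 1) = 0 := by linarith [h01 j i]
    rcases mul_eq_zero.mp this with h | h
    · exact Or.inl h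
    · exact Or.inr (by omega)
  have hnn : ∀ j i, 0 ≤ M j i := fun j i => by rcases hval j i with h | h <;> omega
  have hex : ∀ j, ∃ i, M j i = 1 := fun j => by
    by_contra! h
    have h0 : ∀ i, M j i = 0 := fun i => (hval j i).resolve_right (h i)
    have := hrow j
    simp [h0] at this
  choose f hf using hex
  have hsingle : ∀ j, M j = Pi.single (f j) 1 := by
    intro j
    ext i
    by_cases hi : i = f j
    · rw [hi, hf, Pi.single_eq_same]
    · rw [Pi.single_eq_of_ne hi]
      have h1 := Finset.add_sum_erase Finset.univ (fun i => M j i) (Finset.mem_univ (f j))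
      have h2 := Finset.single_le_sum (fun i _ => hnn j i)
        (Finset.mem_erase.mpr ⟨hi, Finset.mem_univ i⟩)
      have := hrow j
      have := hf j
      have := hnn j i
      linarith
  have hinj : Function.Injective f := by
    intro j k hjk
    by_contra hne
    have := congrFun (congrFun hM' j) k
    rw [Matrix.one_apply_ne hne, Matrix.mul_apply] at this
    simp only [Matrix.transpose_apply, hsq,
      show M k = M j by rw [hsingle, hsingle, hjk]] at this
    exact one_ne_zero this
  exact ⟨Equiv.ofBijective f (Finite.injective_iff_bijective.mp hinj), hsingle⟩

/-! ### Monomial characters of the torus. -/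

theorem Circle.eq_of_forall_zpow_eq {k l : ℤ} (h : ∀ z : Circle, z ^ k = z ^ l) : k = l := by
  by_contra hne
  have h0 : ((k : ℝ) - l) ≠ 0 := sub_ne_zero.mpr (by exact_mod_cast hne)
  -- The test point is chosen so that this power is `-1`.
  have h1 : Circle.exp (Real.pi / (k - l)) ^ (k - l) = 1 := by
    rw [zpow_sub, h, mul_inv_cancel]
  rw [← Circle.exp_intCast_mul, Int.cast_sub, mul_div_cancel₀ _ h0] at h1
  have := congrArg (fun z : Circle => (z : ℂ)) h1
  simp only [Circle.coe_exp, Complex.exp_pi_mul_I, Circle.coe_one] at this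
  norm_num at this

theorem prod_zpow_eq_zpow_sum {ι G : Type*} [Fintype ι] [CommGroup G] (z : G) (m : ι → ℤ) :
    ∏ i, z ^ m i = z ^ ∑ i, m i :=
  (map_prod (zpowersHom G z) (fun i => Multiplicative.ofAdd (m i)) Finset.univ).symm

theorem addChar_map_sum {ι A M : Type*} [Fintype ι] [AddCommMonoid A] [CommMonoid M]
    (ψ : AddChar A M) (f : ι → A) : ψ (∑ i, f i) = ∏ i, ψ (f i) :=
  map_prod ψ.toMonoidHom (fun i => Multiplicative.ofAdd (f i)) Finset.univ

/-- The monomial characters of the torus. -/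
noncomputable def torusMonomial {n : ℕ} (m : Fin n → ℤ) : (Fin n → Circle) →* ℂ where
  toFun s := ((∏ i, s i ^ m i : Circle) : ℂ)
  map_one' := by simp
  map_mul' s t := by simp [mul_zpow, Finset.prod_mul_distrib]

theorem torusMonomial_apply {n : ℕ} (m : Fin n → ℤ) (s : Fin n → Circle) :
    torusMonomial m s = ((∏ i, s i ^ m i : Circle) : ℂ) := rfl

theorem prod_mulSingle_zpow {n : ℕ} (m : Fin n → ℤ) (i : Fin n) (z : Circle) :
    ∏ k, (Pi.mulSingle i z : Fin n → Circle) k ^ m k = z ^ m i := by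
  rw [Finset.prod_eq_single i]
  · simp
  · intro k _ hk
    rw [Pi.mulSingle_eq_of_ne hk, one_zpow]
  · simp

theorem torusMonomial_injective (n : ℕ) :
    Function.Injective (torusMonomial : (Fin n → ℤ) → (Fin n → Circle) →* ℂ) := by
  intro m m' h
  funext i
  refine Circle.eq_of_forall_zpow_eq fun z => Circle.ext ?_
  have := DFunLike.congr_fun h (Pi.mulSingle i z)
  rwa [torusMonomial_apply, torusMonomial_apply, prod_mulSingle_zpow, prod_mulSingle_zpow] at this

/-- The exponents of a sum of monomials on the torus are determined by the sum. -/
theorem sum_eq_of_sum_torusMonomial_eq {n : ℕ} {ι : Type*} [Fintype ι] (m m' : ι → Fin n → ℤ)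
    (h : ∀ s, ∑ j, torusMonomial (m j) s = ∑ j, torusMonomial (m' j) s)
    (F : (Fin n → ℤ) → ℂ) : ∑ j, F (m j) = ∑ j, F (m' j) := by
  -- Independence of characters turns an equality of functions into one of formal sums, on which `F`
  -- extends linearly.
  have hli : LinearIndependent ℂ
      (fun m : Fin n → ℤ => (torusMonomial m : (Fin n → Circle) → ℂ)) :=
    (linearIndependent_monoidHom (Fin n → Circle) ℂ).comp _ (torusMonomial_injective n)
  have key : ∑ j, Finsupp.single (m j) (1 : ℂ) = ∑ j, Finsupp.single (m' j) (1 : ℂ) := by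
    apply hli
    simp only [map_sum, Finsupp.linearCombination_single, one_smul]
    ext s
    simpa using h s
  simpa using congrArg (Finsupp.linearCombination ℂ F) key

theorem trace_conj_unitary {n : ℕ} (g u : U n) :
    Matrix.trace ((g * u * g⁻¹ : U n) : Matrix (Fin n) (Fin n) ℂ) =
      Matrix.trace (u : Matrix (Fin n) (Fin n) ℂ) := by
  rw [Submonoid.coe_mul, Matrix.trace_mul_comm, ← Submonoid.coe_mul]
  congr 2
  group

theorem trace_diagTorus {n : ℕ} (t : Fin n → Circle) :
    Matrix.trace (diagTorus n t : Matrix (Fin n) (Fin n) ℂ) = ∑ j, (t j : ℂ) := by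
  rw [coe_diagTorus, Matrix.trace_diagonal]

/-! ### Weights of an endomorphism and preservation of the trace. -/

/-- A continuous homomorphism maps the diagonal torus, up to conjugation, into itself, and it is
given there by an integer matrix. -/
theorem exists_weights {n : ℕ} (α : U n →* U n) (hα : Continuous α) :
    ∃ (g : U n) (M : Matrix (Fin n) (Fin n) ℤ), ∀ s,
      α (diagTorus n s) = g * diagTorus n (fun j => ∏ i, s i ^ M j i) * g⁻¹ := by
  obtain ⟨g, hg⟩ := exists_diagonalize_commuting (fun s => α (diagTorus n s)) fun s t =>
    (Commute.all s t).map (α.comp (diagTorus n))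
  choose χ hχ using hg
  have hχ' : ∀ s, diagTorus n (χ s) = g⁻¹ * α (diagTorus n s) * g := fun s => by
    rw [hχ]; group
  let X : (Fin n → Circle) →* (Fin n → Circle) :=
    { toFun := χ
      map_one' := diagTorus_injective n (by rw [hχ', map_one, map_one, mul_one, inv_mul_cancel])
      map_mul' := fun s t => diagTorus_injective n (by
        rw [map_mul, hχ', hχ', hχ', map_mul, map_mul]; group) }
  have hX : Continuous X := by
    refine continuous_pi fun j => ?_
    refine Continuous.subtype_mk (f := fun s => ((χ s j : Circle) : ℂ)) ?_ _
    have h1 : Continuous fun s =>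
        ((g⁻¹ * α (diagTorus n s) * g : U n) : Matrix (Fin n) (Fin n) ℂ) j j := by
      have := hα.comp (continuous_diagTorus n)
      exact (continuous_subtype_val.comp
        ((continuous_const.mul this).mul continuous_const)).matrix_elem j j
    refine h1.congr fun s => ?_
    rw [← hχ', coe_diagTorus, Matrix.diagonal_apply_eq]
  have hM : ∀ j i, ∃ k : ℤ, ∀ z, X (Pi.mulSingle i z) j = z ^ k := fun j i =>
    Circle.exists_eq_zpow_of_continuous
      (((Pi.evalMonoidHom (fun _ => Circle) j).comp X).comp
        (MonoidHom.mulSingle (fun _ => Circle) i))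
      ((continuous_apply j).comp (hX.comp (continuous_mulSingle (A := fun _ => Circle) i)))
  choose M hM using hM
  refine ⟨g, M, fun s => ?_⟩
  rw [hχ]
  congr 3
  funext j
  have : s = ∏ i, Pi.mulSingle i (s i) := (Finset.univ_prod_mulSingle s).symm
  change X s j = _
  conv_lhs => rw [this, map_prod, Finset.prod_apply]
  simp only [hM]

/-- A continuous injective endomorphism of `U(n)` fixing the scalars preserves the trace. -/
theorem trace_eq_of_fixes_scalars {n : ℕ} (α : U n →* U n) (hα : Continuous α)
    (hinj : Function.Injective α) (hs : ∀ z, α (scalarU n z) = scalarU n z) (u : U n) :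
    Matrix.trace (α u : Matrix (Fin n) (Fin n) ℂ) =
      Matrix.trace (u : Matrix (Fin n) (Fin n) ℂ) := by
  obtain ⟨g, M, hM⟩ := exists_weights α hα
  have htr : ∀ s, Matrix.trace (α (diagTorus n s) : Matrix (Fin n) (Fin n) ℂ) =
      ∑ j, torusMonomial (M j) s := fun s => by
    rw [hM, trace_conj_unitary, trace_diagTorus]
    rfl
  -- On a scalar `z` the conjugation by `g` disappears, leaving `z` to the row sum equal to `z`.
  have hrow : ∀ j, ∑ i, M j i = 1 := by
    intro j
    refine Circle.eq_of_forall_zpow_eq fun z => ?_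
    have h1 := hM fun _ => z
    rw [← scalarU_apply, hs] at h1
    have h2 : diagTorus n (fun j => ∏ i, z ^ M j i) = scalarU n z := by
      have hc : scalarU n z ∈ Subgroup.center (U n) :=
        (mem_center_iff_scalarU (Nat.one_le_iff_ne_zero.mpr (Fin.pos j).ne') _).mpr ⟨z, rfl⟩
      rw [eq_mul_inv_iff_mul_eq, ← Subgroup.mem_center_iff.mp hc g] at h1
      exact (mul_left_cancel h1).symm
    have h3 := congrFun (diagTorus_injective n (h2.trans (scalarU_apply z))) j
    rw [zpow_one]
    exact (prod_zpow_eq_zpow_sum z (M j)).symm.trans h3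
  -- Permuting `s` is a conjugation in `U n`, so it does not change the trace of the image. Hence
  -- the multiset of rows of `M` is stable under permuting coordinates; summing `m a * m b` over it
  -- gives the Gram matrix.
  have hinv : ∀ (w : Equiv.Perm (Fin n)) a b,
      (M.transpose * M) (w a) (w b) = (M.transpose * M) a b := by
    intro w a b
    have h1 := sum_eq_of_sum_torusMonomial_eq (fun j => M j ∘ w) M (fun s => by
      have h2 : α (diagTorus n (s ∘ w.symm)) =
          α (permU w.symm) * α (diagTorus n s) * (α (permU w.symm))⁻¹ := by
        rw [eq_mul_inv_iff_mul_eq, ← map_mul, ← map_mul, permU_mul_diagTorus]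
      rw [← htr, ← trace_conj_unitary (α (permU w.symm)), ← h2, htr]
      refine Finset.sum_congr rfl fun j _ => ?_
      rw [torusMonomial_apply, torusMonomial_apply,
        ← Equiv.prod_comp w fun i => (s ∘ w.symm) i ^ M j i]
      simp) (fun m => ((m a * m b : ℤ) : ℂ))
    have h2 : ∑ j, M j (w a) * M j (w b) = ∑ j, M j a * M j b := by exact_mod_cast h1
    simpa [Matrix.mul_apply] using h2
  -- A kernel vector of `M` modulo `p` would give, through `ZMod.toCircle`, a nontrivial `p`-torsion
  -- point of the torus killed by `α`.
  have hdet : ∀ p : ℕ, p.Prime → ¬ (p : ℤ) ∣ M.det := by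
    intro p hp hdvd
    have : Fact p.Prime := ⟨hp⟩
    have hd : (M.map (Int.castRingHom (ZMod p))).det = 0 :=
      (RingHom.map_det (Int.castRingHom (ZMod p)) M).symm.trans
        ((ZMod.intCast_zmod_eq_zero_iff_dvd _ _).mpr hdvd)
    obtain ⟨v, hv, hMv⟩ := Matrix.exists_mulVec_eq_zero_iff.mpr hd
    apply hv
    have h1 : (fun j => ∏ i, ZMod.toCircle (v i) ^ M j i) = 1 := by
      funext j
      have h2 := congrFun hMv j
      simp only [Matrix.mulVec, dotProduct, Matrix.map_apply, Int.coe_castRingHom,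
        Pi.zero_apply] at h2
      have h3 := congrArg ZMod.toCircle h2
      rw [addChar_map_sum, AddChar.map_zero_eq_one] at h3
      simp only [← zsmul_eq_mul, AddChar.map_zsmul_eq_zpow] at h3
      exact h3
    have h2 := hM fun i => ZMod.toCircle (v i)
    rw [h1, map_one, mul_one, mul_inv_cancel] at h2
    have h3 := (map_eq_one_iff _ (diagTorus_injective n)).mp ((map_eq_one_iff _ hinj).mp h2)
    funext i
    have h4 := congrFun h3 i
    exact ZMod.injective_toCircle (h4.trans (AddChar.map_zero_eq_one _).symm)
  obtain ⟨w, hw⟩ := exists_perm_of_transpose_mul_self_eq_one M hrow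
    (transpose_mul_self_eq_one_of_invariant M hrow hinv hdet)
  obtain ⟨h, hh⟩ := exists_diagonalize_commuting (fun _ : Unit => u) fun _ _ => Commute.refl u
  obtain ⟨t, rfl⟩ := hh ()
  rw [map_mul, map_mul, map_inv, trace_conj_unitary, trace_conj_unitary, htr, trace_diagTorus,
    ← Equiv.sum_comp w fun j => (t j : ℂ)]
  refine Finset.sum_congr rfl fun j _ => ?_
  rw [torusMonomial_apply, Finset.prod_eq_single (w j)]
  · simp [hw]
  · intro i _ hi
    rw [hw, Pi.single_eq_of_ne hi, zpow_zero]
  · simp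

/-! ### From trace preservation to inner automorphisms. -/

open Matrix in
/-- A trace preserving surjective endomorphism of `U(n)` extends to an algebra automorphism of
the matrix algebra. -/
theorem exists_algEquiv_of_trace_eq {n : ℕ} (α : U n →* U n) (hsurj : Function.Surjective α)
    (htr : ∀ u, trace (α u : Matrix (Fin n) (Fin n) ℂ) = trace (u : Matrix (Fin n) (Fin n) ℂ)) :
    ∃ L : Matrix (Fin n) (Fin n) ℂ ≃ₐ[ℂ] Matrix (Fin n) (Fin n) ℂ,
      ∀ u : U n, L (u : Matrix (Fin n) (Fin n) ℂ) = α u := by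
  have hspan : Submodule.span ℂ (Set.range fun u : U n => (u : Matrix (Fin n) (Fin n) ℂ)) = ⊤ := by
    rw [Subtype.range_coe_subtype]
    exact span_unitaryGroup n
  have hnd : ∀ A : Matrix (Fin n) (Fin n) ℂ,
      (∀ u : U n, trace (A * (u : Matrix (Fin n) (Fin n) ℂ)) = 0) → A = 0 := by
    intro A hA
    have h0 : (traceLinearMap (Fin n) ℂ ℂ).comp (LinearMap.mulLeft ℂ A) = 0 :=
      LinearMap.ext_on_range hspan fun u => by simpa using hA u
    refine Matrix.ext_iff_trace_mul_right.mpr fun B => ?_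
    simpa using LinearMap.congr_fun h0 B
  let φ : (U n →₀ ℂ) →ₗ[ℂ] Matrix (Fin n) (Fin n) ℂ :=
    Finsupp.linearCombination ℂ fun u : U n => (u : Matrix (Fin n) (Fin n) ℂ)
  let ψ : (U n →₀ ℂ) →ₗ[ℂ] Matrix (Fin n) (Fin n) ℂ :=
    Finsupp.linearCombination ℂ fun u : U n => (α u : Matrix (Fin n) (Fin n) ℂ)
  have hpair : ∀ x v, trace (ψ x * (α v : Matrix (Fin n) (Fin n) ℂ)) =
      trace (φ x * (v : Matrix (Fin n) (Fin n) ℂ)) := by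
    intro x v
    induction x using Finsupp.induction_linear with
    | zero => simp
    | add x y hx hy => simp only [map_add, add_mul, trace_add, hx, hy]
    | single u c =>
      simp only [φ, ψ, Finsupp.linearCombination_single, smul_mul_assoc, trace_smul]
      rw [← Submonoid.coe_mul, ← Submonoid.coe_mul, ← map_mul, htr]
  -- The unitaries and their images satisfy the same linear relations, since the trace pairing
  -- detects zero. Surjectivity of `α` lets the images serve as test matrices.
  have hker : ∀ x, φ x = 0 ↔ ψ x = 0 := by
    intro x
    constructor
    · intro h
      refine hnd _ fun u => ?_
      obtain ⟨v, rfl⟩ := hsurj u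
      rw [hpair, h, zero_mul, trace_zero]
    · intro h
      refine hnd _ fun u => ?_
      rw [← hpair, h, zero_mul, trace_zero]
  have hφ : LinearMap.range φ = ⊤ := by
    rw [← hspan, Finsupp.range_linearCombination]
  obtain ⟨s, hs⟩ := φ.exists_rightInverse_of_surjective hφ
  have hs' : ∀ A, φ (s A) = A := fun A => LinearMap.congr_fun hs A
  let L₀ := ψ ∘ₗ s
  have hL₀ : ∀ u : U n, L₀ (u : Matrix (Fin n) (Fin n) ℂ) = α u := by
    intro u
    have h1 : φ (s u - Finsupp.single u 1) = 0 := by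
      rw [map_sub, hs']
      simp [φ]
    have h2 := (hker _).mp h1
    rw [map_sub, sub_eq_zero] at h2
    exact h2.trans (by simp [ψ])
  have hmul : ∀ A B, L₀ (A * B) = L₀ A * L₀ B := by
    have h1 : (LinearMap.mul ℂ (Matrix (Fin n) (Fin n) ℂ)).compr₂ L₀ =
        (LinearMap.mul ℂ (Matrix (Fin n) (Fin n) ℂ)).compl₁₂ L₀ L₀ := by
      refine LinearMap.ext_on_range hspan fun u => LinearMap.ext_on_range hspan fun v => ?_
      have := hL₀ (u * v)
      simp only [map_mul, Submonoid.coe_mul] at this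
      simpa [hL₀] using this
    intro A B
    exact LinearMap.congr_fun₂ h1 A B
  have hone : L₀ 1 = 1 := by
    have := hL₀ 1
    rwa [map_one] at this
  have hinj : Function.Injective L₀ := by
    rw [injective_iff_map_eq_zero]
    intro A hA
    rw [← hs' A]
    exact (hker _).mpr hA
  exact ⟨AlgEquiv.ofBijective (AlgHom.ofLinearMap L₀ hone hmul)
    ⟨hinj, LinearMap.surjective_of_injective hinj⟩, hL₀⟩

/-- If conjugation by an invertible matrix agrees with a self-map of `U(n)`, then it agrees with
conjugation by a unitary matrix. -/
theorem exists_unitary_conj {n : ℕ} (f : U n → U n) (P Q : Matrix (Fin n) (Fin n) ℂ)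
    (hQP : Q * P = 1) (hf : ∀ u : U n, (f u : Matrix (Fin n) (Fin n) ℂ) = P * u * Q) :
    ∃ g : U n, ∀ u, f u = g * u * g⁻¹ := by
  have hPu : ∀ u, (f u : Matrix (Fin n) (Fin n) ℂ) * P = P * u := fun u => by
    rw [hf, mul_assoc, hQP, mul_one]
  -- Unitarity of `f u` makes `P* P` commute with all unitaries, hence scalar; dividing `P` by the
  -- square root of this positive scalar makes it unitary.
  have hcomm : ∀ u : U n, (u : Matrix (Fin n) (Fin n) ℂ) * (star P * P) = star P * P * u := by
    intro u
    have h1 : star P * star (f u : Matrix (Fin n) (Fin n) ℂ) =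
        star (u : Matrix (Fin n) (Fin n) ℂ) * star P := by
      rw [← star_mul, hPu, star_mul]
    have huu : (u : Matrix (Fin n) (Fin n) ℂ) * star (u : Matrix (Fin n) (Fin n) ℂ) = 1 :=
      Matrix.mem_unitaryGroup_iff.mp u.2
    calc (u : Matrix (Fin n) (Fin n) ℂ) * (star P * P)
        = u * (star P * (star (f u : Matrix (Fin n) (Fin n) ℂ) * (f u)) * P) := by
          rw [Matrix.UnitaryGroup.star_mul_self, mul_one]
      _ = u * ((star P * star (f u : Matrix (Fin n) (Fin n) ℂ)) * ((f u) * P)) := by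
          simp only [mul_assoc]
      _ = (u * star (u : Matrix (Fin n) (Fin n) ℂ)) * (star P * (P * u)) := by
          rw [h1, hPu]; simp only [mul_assoc]
      _ = star P * P * u := by rw [huu, one_mul, mul_assoc]
  obtain ⟨c, hc⟩ := exists_eq_scalar_of_commute_unitary _ hcomm
  rcases Nat.eq_zero_or_pos n with rfl | hn
  · exact ⟨1, fun u => Subtype.ext (Subsingleton.elim _ _)⟩
  let i0 : Fin n := ⟨0, hn⟩
  have hc0 : c = ((∑ k, ‖P k i0‖ ^ 2 : ℝ) : ℂ) := by
    have := congrFun (congrFun hc i0) i0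
    rw [Matrix.scalar_apply, Matrix.diagonal_apply_eq] at this
    rw [← this, Matrix.mul_apply, Complex.ofReal_sum]
    refine Finset.sum_congr rfl fun k _ => ?_
    rw [Matrix.star_apply, RCLike.star_def, Complex.conj_mul', Complex.ofReal_pow]
  have hcpos : 0 < ∑ k, ‖P k i0‖ ^ 2 := by
    rw [Finset.sum_pos_iff_of_nonneg fun k _ => sq_nonneg _]
    by_contra! h
    have h0 : ∀ k, P k i0 = 0 := fun k => by
      have := h k (Finset.mem_univ k)
      exact norm_eq_zero.mp (pow_eq_zero_iff two_ne_zero |>.mp (le_antisymm this (sq_nonneg _)))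
    have := congrFun (congrFun hQP i0) i0
    simp [Matrix.mul_apply, h0] at this
  set r : ℝ := ∑ k, ‖P k i0‖ ^ 2 with hr
  have hq : ((Real.sqrt r : ℝ) : ℂ) * (Real.sqrt r : ℝ) = c := by
    rw [← Complex.ofReal_mul, Real.mul_self_sqrt hcpos.le, hc0]
  have hq0 : ((Real.sqrt r : ℝ) : ℂ) ≠ 0 :=
    Complex.ofReal_ne_zero.mpr (Real.sqrt_pos.mpr hcpos).ne'
  let g : U n := ⟨((Real.sqrt r : ℝ) : ℂ)⁻¹ • P, by
    rw [Matrix.mem_unitaryGroup_iff', star_smul, smul_mul_smul_comm, hc, RCLike.star_def, map_inv₀,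
      Complex.conj_ofReal, ← mul_inv, hq, Matrix.scalar_apply, Matrix.smul_eq_diagonal_mul,
      Matrix.diagonal_mul_diagonal, inv_mul_cancel₀ (by rw [← hq]; exact mul_ne_zero hq0 hq0),
      Matrix.diagonal_one]⟩
  refine ⟨g, fun u => ?_⟩
  rw [eq_mul_inv_iff_mul_eq]
  apply Subtype.ext
  simp only [Submonoid.coe_mul, g, mul_smul_comm, smul_mul_assoc, hPu]

/-- A continuous automorphism of `U(n)` fixing the scalars is inner. -/
theorem isInnerAut_of_fixes_scalars {n : ℕ} (α : U n ≃ₜ* U n)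
    (hs : ∀ z, α (scalarU n z) = scalarU n z) : IsInnerAut α := by
  obtain ⟨L, hL⟩ := exists_algEquiv_of_trace_eq (α : U n →* U n) α.surjective
    (trace_eq_of_fixes_scalars (α : U n →* U n) α.continuous α.injective hs)
  -- Skolem–Noether for the endomorphism algebra.
  obtain ⟨T, hT⟩ := AlgEquiv.eq_linearEquivConjAlgEquiv
    ((Matrix.toLinAlgEquiv'.symm.trans L).trans Matrix.toLinAlgEquiv')
  refine exists_unitary_conj α (LinearMap.toMatrix' (T : (Fin n → ℂ) →ₗ[ℂ] (Fin n → ℂ)))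
    (LinearMap.toMatrix' (T.symm : (Fin n → ℂ) →ₗ[ℂ] (Fin n → ℂ))) ?_ fun u => ?_
  · rw [← LinearMap.toMatrix'_comp]
    simp
  · have h1 := AlgEquiv.congr_fun hT (Matrix.toLin' (u : Matrix (Fin n) (Fin n) ℂ))
    have h2 : Matrix.toLin' (L (u : Matrix (Fin n) (Fin n) ℂ)) =
        (T : (Fin n → ℂ) →ₗ[ℂ] (Fin n → ℂ)) ∘ₗ Matrix.toLin' (u : Matrix (Fin n) (Fin n) ℂ) ∘ₗ
          (T.symm : (Fin n → ℂ) →ₗ[ℂ] (Fin n → ℂ)) := by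
      rw [LinearEquiv.conjAlgEquiv_apply] at h1
      rw [← h1]
      change _ = Matrix.toLin' (L (LinearMap.toMatrix' (Matrix.toLin' _)))
      rw [LinearMap.toMatrix'_toLin']
    have h3 := congrArg LinearMap.toMatrix' h2
    rw [LinearMap.toMatrix'_toLin', LinearMap.toMatrix'_comp, LinearMap.toMatrix'_comp,
      LinearMap.toMatrix'_toLin', ← mul_assoc, hL] at h3
    exact h3

/-! ### The action of automorphisms on the centre. -/

theorem exists_zpow_of_scalarU {n : ℕ} (hn : 1 ≤ n) (α : U n ≃ₜ* U n) :
    ∃ k : ℤ, ∀ z, α (scalarU n z) = scalarU n (z ^ k) := by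
  have hmap : ∀ z, ∃ w, scalarU n w = α (scalarU n z) := fun z => by
    rw [← mem_center_iff_scalarU hn, Subgroup.mem_center_iff]
    intro g
    obtain ⟨h, rfl⟩ := α.surjective g
    rw [← map_mul, ← map_mul,
      Subgroup.mem_center_iff.mp ((mem_center_iff_scalarU hn _).mpr ⟨z, rfl⟩) h]
  choose χ hχ using hmap
  let X : Circle →* Circle :=
    { toFun := χ
      map_one' := scalarU_injective hn (by rw [hχ, map_one, map_one])
      map_mul' := fun s t => scalarU_injective hn (by
        rw [map_mul, hχ, hχ, hχ, map_mul, map_mul]) }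
  have hX : Continuous X := by
    refine Continuous.subtype_mk (f := fun z => ((χ z : Circle) : ℂ)) ?_ _
    have h1 : Continuous fun z =>
        (α (scalarU n z) : Matrix (Fin n) (Fin n) ℂ) ⟨0, hn⟩ ⟨0, hn⟩ := by
      have h2 : Continuous (scalarU n) :=
        (continuous_diagTorus n).comp (continuous_pi fun _ => continuous_id)
      exact (continuous_subtype_val.comp (α.continuous.comp h2)).matrix_elem _ _
    refine h1.congr fun z => ?_
    rw [← hχ, coe_scalarU, Matrix.scalar_apply, Matrix.diagonal_apply_eq]
  obtain ⟨k, hk⟩ := Circle.exists_eq_zpow_of_continuous X hX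
  exact ⟨k, fun z => by rw [← hχ, ← hk]; rfl⟩

/-- A continuous automorphism of `U(n)` is inner or inverts the center. -/
theorem inverts_center_of_isOuterAut {n : ℕ} (hn : 1 ≤ n) (α : U n ≃ₜ* U n) (hα : IsOuterAut α)
    (c : U n) (hc : c ∈ Subgroup.center (U n)) : α c = c⁻¹ := by
  obtain ⟨k, hk⟩ := exists_zpow_of_scalarU hn α
  obtain ⟨l, hl⟩ := exists_zpow_of_scalarU hn α.symm
  have hkl : k * l = 1 := Circle.eq_of_forall_zpow_eq fun z => by
    apply scalarU_injective hn
    rw [zpow_mul, ← hl, ← hk, ContinuousMulEquiv.symm_apply_apply, zpow_one]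
  obtain ⟨z, rfl⟩ := (mem_center_iff_scalarU hn c).mp hc
  rcases Int.isUnit_iff.mp (IsUnit.of_mul_eq_one _ hkl) with rfl | rfl
  · exact absurd (isInnerAut_of_fixes_scalars α fun z => by rw [hk, zpow_one]) hα
  · rw [hk, zpow_neg_one, map_inv]

/-- Inner automorphisms fix the scalar matrix `i`, which conjugation sends to `-i`. -/
theorem isOuterAut_complexConj {n : ℕ} (hn : 1 ≤ n) : IsOuterAut (complexConj n) := by
  rintro ⟨g, hg⟩
  let z : Circle := ⟨Complex.I, by simp [Submonoid.unitSphere]⟩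
  have h1 := hg (scalarU n z)
  rw [Subgroup.mem_center_iff.mp ((mem_center_iff_scalarU hn _).mpr ⟨z, rfl⟩) g,
    mul_inv_cancel_right] at h1
  have h2 := congrArg (fun u : U n => (u : Matrix (Fin n) (Fin n) ℂ) ⟨0, hn⟩ ⟨0, hn⟩) h1
  have h3 : star Complex.I = Complex.I := by
    have h4 : star ((scalarU n z : Matrix (Fin n) (Fin n) ℂ) ⟨0, hn⟩ ⟨0, hn⟩) =
      (scalarU n z : Matrix (Fin n) (Fin n) ℂ) ⟨0, hn⟩ ⟨0, hn⟩ := h2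
    simpa only [coe_scalarU, Matrix.scalar_apply, Matrix.diagonal_apply_eq] using h4
  have h4 := congrArg Complex.im h3
  simp at h4
  norm_num at h4

/-! ### The orbit condition as an equation between cochains. -/

section

open groupCohomology CategoryTheory
open scoped IsMulCommutative

/-- Unwinds equality of classes: `f*z` minus `-z` becomes the product `f*z · z`, and the right side
is the coboundary of `c` for the trivial action. -/
theorem pullbackH2_projClass_eq_neg_iff {G : Type} {Γ : Type u} [Group G] [Group Γ]
    (ρ : Γ →* G ⧸ Subgroup.center G) (r : Γ → G)
    (hr : ∀ γ, (r γ : G ⧸ Subgroup.center G) = ρ γ) (f : Γ →* Γ) :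
    (pullbackH2 (Subgroup.center G) f).hom (projClass ρ r hr) = -projClass ρ r hr ↔
      ∃ c : Γ → Subgroup.center G, ∀ g h, projCocycle ρ r hr (f g, f h) *
        projCocycle ρ r hr (g, h) = c h / c (g * h) * c g := by
  have h1 : (pullbackH2 (Subgroup.center G) f).hom (projClass ρ r hr) =
      (H2π (trivialCoeff Γ (Subgroup.center G))).hom
        (mapCocycles₂ f (Rep.ofHom ⟨LinearMap.id, fun _ => rfl⟩ :
          Rep.res f (trivialCoeff Γ (Subgroup.center G)) ⟶ trivialCoeff Γ (Subgroup.center G))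
          (projCocycle₂ ρ r hr)) :=
    H2π_comp_map_apply (A := trivialCoeff Γ (Subgroup.center G)) f _ (projCocycle₂ ρ r hr)
  rw [h1, projClass, ← map_neg]
  refine (H2π_eq_iff _ _).trans ?_
  constructor
  · rintro ⟨x, hx⟩
    refine ⟨fun γ => (x γ).down.toMul, fun g h => ?_⟩
    have h2 := congrFun hx (g, h)
    exact (congrArg (fun t => t.down.toMul) (h2.trans (sub_neg_eq_add _ _))).symm
  · rintro ⟨c, hc⟩
    refine ⟨fun γ => ULift.up (Additive.ofMul (c γ)), ?_⟩
    funext ⟨g, h⟩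
    refine Eq.trans ?_ (sub_neg_eq_add _ _).symm
    exact congrArg (fun t => ULift.up (Additive.ofMul t)) (hc g h).symm

theorem neg_projClass_mem_orbit_iff {G : Type} {Γ : Type u} [Group G] [Group Γ]
    (ρ : Γ →* G ⧸ Subgroup.center G) (r : Γ → G)
    (hr : ∀ γ, (r γ : G ⧸ Subgroup.center G) = ρ γ) :
    -projClass ρ r hr ∈ MulAction.orbit (MulAut Γ) (projClass ρ r hr) ↔
      ∃ (θ : MulAut Γ) (c : Γ → Subgroup.center G), ∀ g h, projCocycle ρ r hr (θ g, θ h) *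
        projCocycle ρ r hr (g, h) = c h / c (g * h) * c g := by
  constructor
  · rintro ⟨θ, hθ⟩
    exact ⟨θ⁻¹, (pullbackH2_projClass_eq_neg_iff ρ r hr (θ⁻¹ : MulAut Γ).toMonoidHom).mp hθ⟩
  · rintro ⟨θ, hθ⟩
    refine ⟨θ⁻¹, ?_⟩
    refine (pullbackH2_projClass_eq_neg_iff ρ r hr ((θ⁻¹)⁻¹ : MulAut Γ).toMonoidHom).mpr ?_
    rw [inv_inv]
    exact hθ

end

/-! ### Lifts to the semidirect product and crossed homomorphisms. -/

theorem projAction_apply_of_lift {G Γ : Type*} [Group G] [Group Γ]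
    (ρ : Γ →* G ⧸ Subgroup.center G) (r : Γ → G)
    (hr : ∀ γ, (r γ : G ⧸ Subgroup.center G) = ρ γ) (γ : Γ) (x : G) :
    projAction ρ γ x = r γ * x * (r γ)⁻¹ := by
  rw [projAction, MonoidHom.comp_apply, ← hr, conjModCenter_mk]

theorem center_mul_eq_div_mul_iff {G : Type*} [Group G] (x y u v w : Subgroup.center G) :
    x * y = v / w * u ↔ x * w = u * v * y⁻¹ := by
  have hcomm : ∀ a b : Subgroup.center G, a * b = b * a := fun a b =>
    Subtype.ext (Subgroup.mem_center_iff.mp b.2 a)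
  rw [div_eq_mul_inv, mul_assoc v, hcomm w⁻¹, ← mul_assoc v, eq_mul_inv_iff_mul_eq,
    eq_mul_inv_iff_mul_eq, hcomm u, mul_assoc, hcomm y, ← mul_assoc]

theorem mul_lift_eq {G : Type} {Γ : Type u} [Group G] [Group Γ]
    (ρ : Γ →* G ⧸ Subgroup.center G) (r : Γ → G)
    (hr : ∀ γ, (r γ : G ⧸ Subgroup.center G) = ρ γ) (g h : Γ) :
    r g * r h = projCocycle ρ r hr (g, h) * r (g * h) := by
  simp [projCocycle]

/-- An automorphism inverting the center which lifts to the semidirect product carries the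
cocycle to its inverse, up to an automorphism of `Γ` and a coboundary. -/
theorem exists_coboundary_of_lifts {G : Type} {Γ : Type u} [Group G] [TopologicalSpace G]
    [Group Γ] [TopologicalSpace Γ] (ρ : Γ →* G ⧸ Subgroup.center G) (r : Γ → G)
    (hr : ∀ γ, (r γ : G ⧸ Subgroup.center G) = ρ γ) (α : G ≃ₜ* G)
    (hα : ∀ c ∈ Subgroup.center G, α c = c⁻¹) (hlift : LiftsToSemidirect ρ α) :
    ∃ (θ : MulAut Γ) (c : Γ → Subgroup.center G), ∀ g h, projCocycle ρ r hr (θ g, θ h) *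
        projCocycle ρ r hr (g, h) = c h / c (g * h) * c g := by
  obtain ⟨Φ, hΦ⟩ := hlift
  have hΦs : ∀ x : G, Φ.symm (SemidirectProduct.inl x) = SemidirectProduct.inl (α.symm x) := by
    intro x
    rw [ContinuousMulEquiv.symm_apply_eq, hΦ, ContinuousMulEquiv.apply_symm_apply]
  have hdecomp : ∀ p : ProjSemidirect ρ,
      p = SemidirectProduct.inl p.left * SemidirectProduct.inr p.right := fun p =>
    (SemidirectProduct.inl_left_mul_inr_right p).symm
  have hright : ∀ p : ProjSemidirect ρ,
      (Φ p).right = (Φ (SemidirectProduct.inr p.right)).right := fun p => by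
    conv_lhs => rw [hdecomp p, map_mul, hΦ, SemidirectProduct.mul_right,
      SemidirectProduct.right_inl, one_mul]
  have hright' : ∀ p : ProjSemidirect ρ,
      (Φ.symm p).right = (Φ.symm (SemidirectProduct.inr p.right)).right := fun p => by
    conv_lhs => rw [hdecomp p, map_mul, hΦs, SemidirectProduct.mul_right,
      SemidirectProduct.right_inl, one_mul]
  -- `Φ` and its inverse preserve the copy of `G`, so `Φ` descends to the quotient `Γ`.
  let θ : MulAut Γ :=
    { toFun := fun γ => (Φ (SemidirectProduct.inr γ)).right
      invFun := fun γ => (Φ.symm (SemidirectProduct.inr γ)).right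
      left_inv := fun γ => by
        beta_reduce
        rw [← hright', ContinuousMulEquiv.symm_apply_apply, SemidirectProduct.right_inr]
      right_inv := fun γ => by
        beta_reduce
        rw [← hright, ContinuousMulEquiv.apply_symm_apply, SemidirectProduct.right_inr]
      map_mul' := fun γ δ => by
        rw [map_mul, map_mul, SemidirectProduct.mul_right] }
  let a : Γ → G := fun γ => (Φ (SemidirectProduct.inr γ)).left
  have hθ : ∀ γ, (Φ (SemidirectProduct.inr γ)).right = θ γ := fun _ => rfl
  have ha : ∀ γ, (Φ (SemidirectProduct.inr γ)).left = a γ := fun _ => rfl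
  have hamul : ∀ γ δ, a (γ * δ) = a γ * (r (θ γ) * a δ * (r (θ γ))⁻¹) := fun γ δ => by
    rw [← ha, map_mul, map_mul, SemidirectProduct.mul_left, ha, ha, hθ,
      projAction_apply_of_lift ρ r hr]
  have hconj : ∀ γ x, α (r γ * x * (r γ)⁻¹) * a γ = a γ * (r (θ γ) * α x * (r (θ γ))⁻¹) := by
    intro γ x
    have h1 : (SemidirectProduct.inl (r γ * x * (r γ)⁻¹) * SemidirectProduct.inr γ :
        ProjSemidirect ρ) = SemidirectProduct.inr γ * SemidirectProduct.inl x := by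
      rw [← projAction_apply_of_lift ρ r hr, SemidirectProduct.inl_aut, map_inv, inv_mul_cancel_right]
    have h2 := congrArg (fun p => (Φ p).left) h1
    beta_reduce at h2
    rwa [map_mul Φ, map_mul Φ, hΦ, hΦ, SemidirectProduct.mul_left, SemidirectProduct.left_inl,
      SemidirectProduct.right_inl, map_one, MulAut.one_apply, SemidirectProduct.mul_left,
      SemidirectProduct.left_inl, ha, hθ, projAction_apply_of_lift ρ r hr] at h2
  -- By `hconj`, `a γ * r (θ γ)` and `α (r γ)` act identically by conjugation on the image of `α`,
  -- which is all of `G`.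
  have hcen : ∀ γ, a γ * r (θ γ) * (α (r γ))⁻¹ ∈ Subgroup.center G := by
    intro γ
    rw [Subgroup.mem_center_iff]
    intro y
    obtain ⟨x, hx⟩ := α.surjective ((α (r γ))⁻¹ * y * α (r γ))
    have h1 := hconj γ x
    rw [map_mul, map_mul, map_inv, hx] at h1
    have h2 : y * a γ = a γ * r (θ γ) * (α (r γ))⁻¹ * y * α (r γ) * (r (θ γ))⁻¹ := by
      calc y * a γ = α (r γ) * ((α (r γ))⁻¹ * y * α (r γ)) * (α (r γ))⁻¹ * a γ := by group
        _ = _ := by rw [h1]; group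
    calc y * (a γ * r (θ γ) * (α (r γ))⁻¹) = y * a γ * r (θ γ) * (α (r γ))⁻¹ := by group
      _ = _ := by rw [h2]; group
  let c : Γ → Subgroup.center G := fun γ => ⟨_, hcen γ⟩
  have hc : ∀ γ, a γ * r (θ γ) = c γ * α (r γ) := fun γ => by simp [c]
  refine ⟨θ, c, fun g h => ?_⟩
  set z' := projCocycle ρ r hr (θ g, θ h) with hz'
  set z := projCocycle ρ r hr (g, h) with hz
  have hcomm : ∀ (x : Subgroup.center G) (y : G), y * x = x * y := fun x y =>
    Subgroup.mem_center_iff.mp x.2 y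
  -- The same product is evaluated by the crossed homomorphism law here, and in `h2` through `α`,
  -- where inversion of the centre produces `z⁻¹`.
  have h1 : (a g * r (θ g)) * (a h * r (θ h)) = z' * c (g * h) * α (r (g * h)) := by
    calc (a g * r (θ g)) * (a h * r (θ h))
        = a (g * h) * (r (θ g) * r (θ h)) := by rw [hamul]; simp only [mul_assoc, inv_mul_cancel_left]
      _ = (a (g * h) * z') * r (θ (g * h)) := by
          rw [mul_lift_eq ρ r hr, ← hz', map_mul, mul_assoc]
      _ = _ := by rw [hcomm, mul_assoc, hc, ← mul_assoc]
  have h2 : (a g * r (θ g)) * (a h * r (θ h)) = c g * c h * (z : G)⁻¹ * α (r (g * h)) := by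
    calc (a g * r (θ g)) * (a h * r (θ h))
        = c g * (α (r g) * c h) * α (r h) := by rw [hc, hc]; group
      _ = c g * c h * α (r g * r h) := by rw [hcomm, map_mul]; group
      _ = _ := by rw [mul_lift_eq ρ r hr, ← hz, map_mul, hα _ z.2, mul_assoc _ _ (α _)]
  have h3 : z' * c (g * h) = c g * c h * z⁻¹ :=
    Subtype.ext (mul_right_cancel (h1.symm.trans h2))
  exact (center_mul_eq_div_mul_iff _ _ _ _ _).mpr h3

/-- A crossed homomorphism compatible with `α` and `θ` gives a lift of `α`. -/
theorem liftsToSemidirect_of_crossedHom {G Γ : Type*} [Group G] [TopologicalSpace G]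
    [IsTopologicalGroup G] [Group Γ] [TopologicalSpace Γ] [DiscreteTopology Γ]
    (ρ : Γ →* G ⧸ Subgroup.center G) (α : G ≃ₜ* G) (θ : MulAut Γ) (a : Γ → G)
    (ha : ∀ γ δ, a (γ * δ) = a γ * projAction ρ (θ γ) (a δ))
    (hconj : ∀ γ x, α (projAction ρ γ x) * a γ = a γ * projAction ρ (θ γ) (α x)) :
    LiftsToSemidirect ρ α := by
  have hleft : Continuous fun p : ProjSemidirect ρ => p.left :=
    continuous_fst.comp (continuous_induced_dom
      (f := fun p : ProjSemidirect ρ => (p.left, p.right)))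
  have hright : Continuous fun p : ProjSemidirect ρ => p.right :=
    continuous_snd.comp (continuous_induced_dom
      (f := fun p : ProjSemidirect ρ => (p.left, p.right)))
  have hmk : ∀ (f : ProjSemidirect ρ → G) (k : Γ → Γ), Continuous f →
      Continuous fun p : ProjSemidirect ρ => (⟨f p, k p.right⟩ : ProjSemidirect ρ) :=
    fun f k hf => continuous_induced_rng.mpr
      (hf.prodMk ((continuous_of_discreteTopology (f := k)).comp hright))
  have ha1 : a 1 = 1 := by
    have := ha 1 1
    rw [mul_one, map_one, map_one, MulAut.one_apply] at this
    exact left_eq_mul.mp this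
  -- The lift sends `x γ` to `α(x) a(γ) θ(γ)`; `hconj` moves `a` past the action in the product.
  refine ⟨
    { toFun := fun p => ⟨α p.left * a p.right, θ p.right⟩
      invFun := fun p => ⟨α.symm (p.left * (a (θ.symm p.right))⁻¹), θ.symm p.right⟩
      left_inv := fun p => by ext <;> simp
      right_inv := fun p => by ext <;> simp
      map_mul' := fun p q => by
        ext
        · change α (p.left * projAction ρ p.right q.left) * a (p.right * q.right) =
            α p.left * a p.right * projAction ρ (θ p.right) (α q.left * a q.right)
          rw [map_mul, map_mul, ha, ← mul_assoc, mul_assoc (α p.left), hconj]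
          simp only [mul_assoc]
        · exact map_mul θ _ _
      continuous_toFun := hmk _ _ ((α.continuous.comp hleft).mul
        (continuous_of_discreteTopology.comp hright))
      continuous_invFun := hmk _ _ (α.symm.continuous.comp (hleft.mul
        ((continuous_of_discreteTopology (f := fun γ => a (θ.symm γ))).comp hright).inv)) },
    fun x => ?_⟩
  ext
  · change α x * a 1 = α x
    rw [ha1, mul_one]
  · exact map_one θ

/-- Inner automorphisms lift to the semidirect product. -/
theorem liftsToSemidirect_of_isInnerAut {G Γ : Type*} [Group G] [TopologicalSpace G]
    [IsTopologicalGroup G] [Group Γ] [TopologicalSpace Γ] [DiscreteTopology Γ]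
    (ρ : Γ →* G ⧸ Subgroup.center G) (α : G ≃ₜ* G) (hα : IsInnerAut α) :
    LiftsToSemidirect ρ α := by
  obtain ⟨g, hg⟩ := hα
  -- This cocycle is the `G`-component of `g γ g⁻¹`: the lift is conjugation by `g` in the
  -- semidirect product.
  refine liftsToSemidirect_of_crossedHom ρ α 1 (fun γ => g * (projAction ρ γ g)⁻¹) ?_ ?_
  · intro γ δ
    simp [mul_assoc]
  · intro γ x
    simp [hg, mul_assoc]

/-- If the cocycle is carried to its inverse, up to an automorphism of `Γ` and a coboundary, then
the automorphisms inverting the center lift to the semidirect product. -/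
theorem liftsToSemidirect_of_coboundary {G : Type} {Γ : Type u} [Group G] [TopologicalSpace G]
    [IsTopologicalGroup G] [Group Γ] [TopologicalSpace Γ] [DiscreteTopology Γ]
    (ρ : Γ →* G ⧸ Subgroup.center G) (r : Γ → G)
    (hr : ∀ γ, (r γ : G ⧸ Subgroup.center G) = ρ γ) (α : G ≃ₜ* G)
    (hα : ∀ c ∈ Subgroup.center G, α c = c⁻¹) (θ : MulAut Γ) (c : Γ → Subgroup.center G)
    (hc : ∀ g h, projCocycle ρ r hr (θ g, θ h) *
        projCocycle ρ r hr (g, h) = c h / c (g * h) * c g) : LiftsToSemidirect ρ α := by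
  have hcomm : ∀ (x : Subgroup.center G) (y : G), y * x = x * y := fun x y =>
    Subgroup.mem_center_iff.mp x.2 y
  -- The witness solves `a γ * r (θ γ) = c γ * α (r γ)` for `a γ`, the relation that defined `c` in
  -- the converse.
  refine liftsToSemidirect_of_crossedHom ρ α θ
    (fun γ => c γ * α (r γ) * (r (θ γ))⁻¹) (fun g h => ?_) fun γ x => ?_
  · rw [projAction_apply_of_lift ρ r hr]
    set z' := projCocycle ρ r hr (θ g, θ h) with hz'
    set z := projCocycle ρ r hr (g, h) with hz
    have h3 : c (g * h) * z' = c g * c h * z⁻¹ := by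
      rw [← (center_mul_eq_div_mul_iff _ _ _ _ _).mp (hc g h)]
      exact Subtype.ext (hcomm _ _)
    have h4 : α (r g) * α (r h) = (z : G)⁻¹ * α (r (g * h)) := by
      rw [← map_mul, mul_lift_eq ρ r hr, ← hz, map_mul, hα _ z.2]
    have h5 : (r (θ (g * h)))⁻¹ = z' * (r (θ h))⁻¹ * (r (θ g))⁻¹ := by
      rw [mul_assoc, ← mul_inv_rev, mul_lift_eq ρ r hr, ← hz', mul_inv_rev, ← map_mul, ← mul_assoc,
        ← hcomm, mul_inv_cancel_right]
    calc c (g * h) * α (r (g * h)) * (r (θ (g * h)))⁻¹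
        = ((c (g * h) * z' : Subgroup.center G) : G) * α (r (g * h)) *
            ((r (θ h))⁻¹ * (r (θ g))⁻¹) := by
          rw [h5, Subgroup.coe_mul, mul_assoc _ (z' : G), ← hcomm z' (α _)]
          simp only [mul_assoc]
      _ = c g * (c h * ((z : G)⁻¹ * α (r (g * h)))) * ((r (θ h))⁻¹ * (r (θ g))⁻¹) := by
          rw [h3]; simp only [Subgroup.coe_mul, Subgroup.coe_inv, mul_assoc]
      _ = c g * (c h * α (r g)) * α (r h) * ((r (θ h))⁻¹ * (r (θ g))⁻¹) := by
          rw [← h4]; simp only [mul_assoc]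
      _ = _ := by rw [← hcomm (c h)]; group
  · rw [projAction_apply_of_lift ρ r hr, projAction_apply_of_lift ρ r hr, map_mul, map_mul, map_inv]
    calc α (r γ) * α x * (α (r γ))⁻¹ * (c γ * α (r γ) * (r (θ γ))⁻¹)
        = (α (r γ) * α x * (α (r γ))⁻¹ * c γ) * (α (r γ) * (r (θ γ))⁻¹) := by group
      _ = _ := by rw [hcomm]; group

/-! ### The equivalence. -/

/-- For an outer automorphism of `U(n)`, lifting to the semidirect product is a condition on the
cohomology class only. -/
theorem liftsToSemidirect_iff_of_isOuterAut {n : ℕ} (hn : 1 ≤ n)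
    {Γ : Type u} [Group Γ] [TopologicalSpace Γ] [DiscreteTopology Γ]
    (ρ : Γ →* PU n) (r : Γ → U n) (hr : ∀ γ, (r γ : PU n) = ρ γ)
    (σ : U n ≃ₜ* U n) (hσ : IsOuterAut σ) :
    LiftsToSemidirect ρ σ ↔
      -projClass ρ r hr ∈ MulAction.orbit (MulAut Γ) (projClass ρ r hr) := by
  have hinv := inverts_center_of_isOuterAut hn σ hσ
  rw [neg_projClass_mem_orbit_iff]
  exact ⟨exists_coboundary_of_lifts ρ r hr σ hinv, fun ⟨θ, c, hc⟩ =>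
    liftsToSemidirect_of_coboundary ρ r hr σ hinv θ c hc⟩

/-- Here `z̄` is written additively, so that its inverse is `-z̄`. The third condition is
about an arbitrary fixed outer automorphism `σ`, and complex conjugation is one. -/
theorem corollary1p9 {n : ℕ} (hn : 1 ≤ n)
    {Γ : Type u} [Group Γ] [TopologicalSpace Γ] [DiscreteTopology Γ]
    (ρ : Γ →* PU n) (r : Γ → U n) (hr : ∀ γ, (r γ : PU n) = ρ γ) :
    IsOuterAut (complexConj n) ∧
    ∀ σ : U n ≃ₜ* U n, IsOuterAut σ →
      List.TFAE [
        ∀ α : U n ≃ₜ* U n, LiftsToSemidirect ρ α,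
        ∀ α : U n ≃ₜ* U n, IsOuterAut α → LiftsToSemidirect ρ α,
        LiftsToSemidirect ρ σ,
        -projClass ρ r hr ∈ MulAction.orbit (MulAut Γ) (projClass ρ r hr)] := by
  refine ⟨isOuterAut_complexConj hn, fun σ hσ => ?_⟩
  have key := liftsToSemidirect_iff_of_isOuterAut hn ρ r hr
  tfae_have 1 → 2 := fun h α _ => h α
  tfae_have 2 → 3 := fun h => h σ hσ
  tfae_have 3 → 4 := (key σ hσ).mp
  tfae_have 4 → 1 := fun h α => by
    by_cases hα : IsInnerAut α
    · exact liftsToSemidirect_of_isInnerAut ρ α hα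
    · exact (key α hα).mpr h
  tfae_finish
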